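/- **Setting.** Let $\mathcal I$ be a finite set of players with finite action sets $A_i$, let $A=\prod_i A_i$ and $U=\mathbb R^{|\mathcal I|\times|A|}$. Let $\Theta\subseteq\mathbb R^d$ be compact and convex, and let $g:\Theta\to U$ be an embedding that is Lipschitz with constant $K$ for the sup-norms; write $u_i(a,\theta)=g(\theta)_{i,a}$. Let $(T_i^*,\kappa_i^*)_{i\in\mathcal I}$ be the universal type space over $\Theta$ (hierarchies of beliefs that are coherent and have common certainty of coherency, with $\kappa_i^*(t_i)\in\Delta(\Theta\times T^*_{-i})$ the belief that preserves the hierarchy $t_i$). *Rationalizability.* Put $S_i^0[t_i]=A_i$, and let $a_i\in S_i^{k}[t_i]$ iff $a_i$ is a best reply to some $\pi\in\Delta(\Theta\times T^*_{-i}\times A_{-i})$ whose marginal on $\Theta\times T^*_{-i}$ is $\kappa_i^*(t_i)$ and under which $a_j\in S_j^{k-1}[t_j]$ for all $j\ne i$ with probability one. The action $a_i$ is rationalizable for $t_i$ if $a_i\in\bigcap_k S_i^k[t_i]$; it is strictly rationalizable if the same holds with "strict best reply" in place of "best reply" throughout. *$\delta$-strict rationalizability.* A family of sets $R_i[t_i]\subseteq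 A_i$ ($i\in\mathcal I$, $t_i\in T_i^*$; empty sets are allowed) has the $\delta$-strict best reply property if for every $i$, $t_i$ and $a_i\in R_i[t_i]$ there is a measurable $\sigma_{-i}:\Theta\times T^*_{-i}\to\Delta(A_{-i})$ such that, for $\kappa_i^*(t_i)$-almost every $(\theta,t_{-i})$, $\sigma_{-i}(\theta,t_{-i})$ is supported in $\prod_{j\neq i}R_j[t_j]$, and $$\int u_i(a_i,\sigma_{-i}(\theta,t_{-i}),\theta)\,d\kappa_i^*(t_i)-\int u_i(a_i',\sigma_{-i}(\theta,t_{-i}),\theta)\,d\kappa_i^*(t_i)\ \ge\ \delta\qquad\text{for all } a_i'\ne a_i .$$ The action $a_i$ is $\delta$-strictly rationalizable for $t_i$ if $a_i\in R_i[t_i]$ for some such family. *Learning.* Let $\mathcal Z$ be a finite set and let $Z_1,Z_2,\dots$ be i.i.d. with law $Q$ on $\mathcal Z$; let $P=Q^{\otimes\infty}$, let $Z^n=(Z_1,\dots,Z_n)$ and let $P^n$ be its law. Let $\mathcal M$ be a set of learning rules, i.e. of maps $\mu:\bigcup_{n\ge1}\mathcal Z^n\to\Delta(\Theta)$. For a data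 set $\mathbf z_n\in\mathcal Z^n$ let $\mathscr B(\mathbf z_n)=\{\mu(\mathbf z_n):\mu\in\mathcal M\}$ and $\mathscr C(\mathbf z_n)=\bigcup_{\mu\in\mathcal M}\operatorname{supp}\mu(\mathbf z_n)$. For $\mathscr B\subseteq\Delta(\Theta)$ let $T_i^{\mathscr B}\subseteq T_i^*$ be the set of types of player $i$ with common certainty that every player's first-order belief lies in $\mathscr B$, and let $$\underline p^n(a_i)=P^n\left(\{\mathbf z_n: a_i\text{ is rationalizable for every } t_i\in T_i^{\mathscr B(\mathbf z_n)}\}\right).$$ **Proposition.** Let $\theta^\infty\in\Theta$ be such that $\sup_{\theta\in\mathscr C(Z^n)}\|\theta-\theta^\infty\|_\infty\to0$ $P$-almost surely as $n\to\infty$ (with the convention $\sup\emptyset=0$). Let $t_i^\infty\in T_i^*$ be the type with common certainty that every player's first-order belief is the point mass at $\theta^\infty$, and suppose that the action $a_i\in A_i$ is strictly rationalizable for $t_i^\infty$. Then $$\delta^\infty:=\sup\{\delta: a_i\text{ is }\delta\text{-strictly rationalizable for } t_i^\infty\}\in(0,\infty]$$ is strictly positive, and for every $n\ge1$, $$\underline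 p^n(a_i)\ \ge\ 1-\frac{2K}{\delta^\infty}\,\mathbb E\left[\sup_{\theta\in\mathscr C(Z^n)}\|\theta-\theta^\infty\|_\infty\right]$$ (with $2K/\infty=0$). -/

import Mathlib

open MeasureTheory ProbabilityTheory Set Filter Topology
open scoped ENNReal NNReal

namespace LearningGames

/-! ### Hierarchies of beliefs -/

/-- On a compact metrizable space, the σ-algebra on `Δ(E)` is the Borel σ-algebra of the weak
topology. -/
instance probabilityMeasure_borelSpace {E : Type*} [TopologicalSpace E] [CompactSpace E]
    [TopologicalSpace.MetrizableSpace E] [MeasurableSpace E] [BorelSpace E] :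
    BorelSpace (ProbabilityMeasure E) := by
  let _ : MetricSpace E := TopologicalSpace.metrizableSpaceMetric E
  let _ : MetricSpace (ProbabilityMeasure E) := TopologicalSpace.metrizableSpaceMetric _
  refine ⟨le_antisymm ?_ ?_⟩
  · have hle : @Measurable _ _ (borel (ProbabilityMeasure E)) _
        (fun μ : ProbabilityMeasure E => (μ : Measure E)) := by
      let _ : MeasurableSpace (ProbabilityMeasure E) := borel _
      have _ : BorelSpace (ProbabilityMeasure E) := ⟨rfl⟩
      refine Measurable.measure_of_isPiSystem_of_isProbabilityMeasure (S := {s | IsClosed s})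
        ?_ isPiSystem_isClosed ?_
      · exact (BorelSpace.measurable_eq (α := E)).trans borel_eq_generateFrom_isClosed
      · intro F hF
        refine UpperSemicontinuous.measurable ?_
        rw [upperSemicontinuous_iff_limsup_le]
        intro μ
        exact ProbabilityMeasure.limsup_measure_closed_le_of_tendsto tendsto_id hF
    exact measurable_iff_comap_le.1 hle
  · let s : Set (Set (ProbabilityMeasure E)) :=
      {V | ∃ (f : BoundedContinuousFunction E NNReal) (U : Set NNReal), IsOpen U ∧
        V = (fun μ : ProbabilityMeasure E => μ.toWeakDualBCNN f) ⁻¹' U}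
    have hs : (inferInstance : TopologicalSpace (ProbabilityMeasure E)) =
        TopologicalSpace.generateFrom s := by
      refine le_antisymm (le_generateFrom ?_) ?_
      · rintro V ⟨f, U, hU, rfl⟩
        refine hU.preimage ?_
        exact (WeakBilin.eval_continuous _ f).comp
          (ProbabilityMeasure.toWeakDualBCNN_continuous (Ω := E))
      · rw [← continuous_id_iff_le]
        refine continuous_induced_rng.2 (continuous_induced_rng.2 (continuous_induced_rng.2 ?_))
        refine @continuous_pi _ _ _ (TopologicalSpace.generateFrom s) _ _ fun f => ?_
        refine @continuous_def _ _ (TopologicalSpace.generateFrom s) _ _ |>.2 fun U hU => ?_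
        exact TopologicalSpace.isOpen_generateFrom_of_mem ⟨f, U, hU, rfl⟩
    rw [borel_eq_generateFrom_of_subbasis hs]
    refine MeasurableSpace.generateFrom_le ?_
    rintro V ⟨f, U, hU, rfl⟩
    refine (Measurable.ennreal_toNNReal ?_) hU.measurableSet
    refine (Measure.measurable_lintegral ?_).comp measurable_subtype_coe
    exact measurable_coe_nnreal_ennreal.comp f.continuous.measurable

/-- A random sequence realizing a consistent sequence of laws. -/
theorem exists_sequence_of_laws (X Y : ℕ → Type) [∀ n, MeasurableSpace (X n)]
    [∀ n, MeasurableSpace (Y n)] [∀ n, StandardBorelSpace (Y n)] [StandardBorelSpace (X 0)]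
    (e : ∀ n, X n × Y n → X (n + 1)) (he : ∀ n, Measurable (e n))
    (μ : ∀ n, Measure (X n)) (ν : ∀ n, Measure (X n × Y n)) [∀ n, IsProbabilityMeasure (μ n)]
    [∀ n, IsProbabilityMeasure (ν n)]
    (hfst : ∀ n, (ν n).map Prod.fst = μ n) (hmap : ∀ n, (ν n).map (e n) = μ (n + 1)) :
    ∃ (P : Measure (ℕ → unitInterval)) (x : ∀ n, (ℕ → unitInterval) → X n)
      (y : ∀ n, (ℕ → unitInterval) → Y n), IsProbabilityMeasure P ∧ (∀ n, Measurable (x n)) ∧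
      (∀ n, Measurable (y n)) ∧ (∀ n ω, x (n + 1) ω = e n (x n ω, y n ω)) ∧
      ∀ n, P.map (x n) = μ n := by
  have hX0 : Nonempty (X 0) := (μ 0).nonempty_of_neZero
  have hY : ∀ n, Nonempty (Y n) := fun n => ((ν n).nonempty_of_neZero).map Prod.snd
  obtain ⟨f0, hf0, hf0'⟩ := (μ 0).exists_measurable_map_eq
  choose f hf hf' using fun n => (ν n).condKernel.exists_measurable_map_eq_unitInterval
  let P : Measure (ℕ → unitInterval) := Measure.infinitePi fun _ => volume
  let x : ∀ n, (ℕ → unitInterval) → X n := fun n ω =>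
    Nat.rec (motive := X) (f0 (ω 0)) (fun k z => e k (z, f k z (ω (k + 1)))) n
  have hx0 : ∀ ω, x 0 ω = f0 (ω 0) := fun _ => rfl
  have hxs : ∀ n ω, x (n + 1) ω = e n (x n ω, f n (x n ω) (ω (n + 1))) := fun _ _ => rfl
  have hfac : ∀ n, ∃ h : ((Finset.range (n + 1) : Finset ℕ) → unitInterval) → X n, Measurable h ∧
      ∀ ω, x n ω = h (fun i => ω i) := by
    intro n
    induction n with
    | zero => exact ⟨fun ω => f0 (ω ⟨0, by simp⟩), by fun_prop, fun ω => rfl⟩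
    | succ n ih =>
      obtain ⟨h, hh, hx⟩ := ih
      have hmem : ∀ i : (Finset.range (n + 1) : Finset ℕ), (i : ℕ) ∈ Finset.range (n + 1 + 1) :=
        fun i => Finset.mem_range.2 ((Finset.mem_range.1 i.2).trans (Nat.lt_succ_self _))
      refine ⟨fun ω => e n (h fun i => ω ⟨i, hmem i⟩,
        f n (h fun i => ω ⟨i, hmem i⟩) (ω ⟨n + 1, by simp⟩)), ?_, ?_⟩
      · have h1 : Measurable fun ω : ((Finset.range (n + 1 + 1) : Finset ℕ) → unitInterval) =>
            h fun i => ω ⟨i, hmem i⟩ := by fun_prop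
        refine (he n).comp (h1.prodMk ?_)
        exact (hf n).comp (h1.prodMk (measurable_pi_apply _))
      · intro ω
        rw [hxs, hx]
  have hxm : ∀ n, Measurable (x n) := by
    intro n
    obtain ⟨h, hh, hx⟩ := hfac n
    have : x n = fun ω => h (fun i => ω i) := funext hx
    rw [this]
    fun_prop
  have hym : ∀ n, Measurable fun ω => f n (x n ω) (ω (n + 1)) := fun n =>
    (hf n).comp ((hxm n).prodMk (measurable_pi_apply _))
  have hcoord : ∀ k, P.map (fun ω => ω k) = volume := fun k =>
    Measure.infinitePi_map_eval (fun _ => (volume : Measure unitInterval)) k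
  refine ⟨P, x, fun n ω => f n (x n ω) (ω (n + 1)), inferInstance, hxm, hym, hxs, ?_⟩
  intro n
  induction n with
  | zero =>
    have : x 0 = f0 ∘ fun ω => ω 0 := rfl
    rw [this, ← Measure.map_map hf0 (measurable_pi_apply 0), hcoord, hf0']
  | succ n ih =>
    have hind : IndepFun (x n) (fun ω => ω (n + 1)) P := by
      have h1 : iIndepFun (fun (i : ℕ) (ω : ℕ → unitInterval) => ω i) P :=
        iIndepFun_infinitePi (P := fun _ : ℕ => (volume : Measure unitInterval))
          (X := fun _ => id) (fun _ => measurable_id)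
      have h2 := h1.indepFun_finset (Finset.range (n + 1)) {n + 1} (by simp)
        (fun i => measurable_pi_apply i)
      obtain ⟨h, hh, hx⟩ := hfac n
      have h3 := h2.comp hh (measurable_pi_apply (⟨n + 1, by simp⟩ : ({n + 1} : Finset ℕ)))
      have h4 : x n = h ∘ fun ω i => ω i := funext hx
      rw [h4]
      exact h3
    have hjoint := (indepFun_iff_map_prod_eq_prod_map_map (hxm n).aemeasurable
      (measurable_pi_apply (n + 1)).aemeasurable).1 hind
    rw [ih, hcoord] at hjoint
    have hg : Measurable fun p : X n × unitInterval => (p.1, f n p.1 p.2) :=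
      measurable_fst.prodMk (hf n)
    have hν : P.map (fun ω => (x n ω, f n (x n ω) (ω (n + 1)))) = ν n := by
      have : (fun ω => (x n ω, f n (x n ω) (ω (n + 1)))) =
          (fun p : X n × unitInterval => (p.1, f n p.1 p.2)) ∘
            fun ω : ℕ → unitInterval => (x n ω, ω (n + 1)) := rfl
      rw [this, ← Measure.map_map hg ((hxm n).prodMk (measurable_pi_apply _)), hjoint]
      conv_rhs => rw [← (ν n).disintegrate (ν n).condKernel]
      ext s hs
      rw [Measure.map_apply hg hs, Measure.prod_apply (hg hs), Measure.compProd_apply hs,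
        Measure.fst, hfst]
      refine lintegral_congr fun a => ?_
      rw [← hf' n a, Measure.map_apply (by exact (hf n).comp measurable_prodMk_left)
        (measurable_prodMk_left hs)]
      rfl
    have : x (n + 1) = e n ∘ fun ω => (x n ω, f n (x n ω) (ω (n + 1))) := rfl
    rw [this, ← Measure.map_map (he n) ((hxm n).prodMk (hym n)), hν, hmap]

/-- Compact metrizable spaces with their Borel σ-algebra. -/
structure CompactBorel where
  carrier : Type
  [top : TopologicalSpace carrier]
  [compact : CompactSpace carrier]
  [metrizable : TopologicalSpace.MetrizableSpace carrier]
  [meas : MeasurableSpace carrier]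
  [borel : BorelSpace carrier]

attribute [instance] CompactBorel.top CompactBorel.compact CompactBorel.metrizable
  CompactBorel.meas CompactBorel.borel

instance compactBorel_secondCountable (X : CompactBorel) : SecondCountableTopology X.carrier := by
  let _ : MetricSpace X.carrier := TopologicalSpace.metrizableSpaceMetric X.carrier
  infer_instance

/-- `Δ(X)` with the weak topology. -/
noncomputable def CompactBorel.prob (X : CompactBorel) : CompactBorel :=
  ⟨ProbabilityMeasure X.carrier⟩

/-- `X × ∏ j, Δ(Y j)`. -/
noncomputable def CompactBorel.extend (X : CompactBorel) {J : Type} [Finite J]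
    (Y : J → CompactBorel) : CompactBorel :=
  have : ∀ j, SecondCountableTopology (ProbabilityMeasure (Y j).carrier) := fun j =>
    compactBorel_secondCountable (Y j).prob
  have : Fintype J := Fintype.ofFinite J
  ⟨X.carrier × ((j : J) → ProbabilityMeasure (Y j).carrier)⟩

instance compactBorel_standardBorel (X : CompactBorel) : StandardBorelSpace X.carrier := by
  let _ : MetricSpace X.carrier := TopologicalSpace.metrizableSpaceMetric X.carrier
  infer_instance

section TypeSpace

variable {I : Type} [Finite I] {S : Type} [TopologicalSpace S] [CompactSpace S]
  [TopologicalSpace.MetrizableSpace S] [MeasurableSpace S] [BorelSpace S]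

variable (I S) in
/-- The domains of uncertainty: `X_i^0 = S` and
`X_i^(n+1) = X_i^n × ∏_{j ≠ i} Δ(X_j^n)`. -/
noncomputable def beliefDomain : ℕ → I → CompactBorel
  | 0, _ => ⟨S⟩
  | n + 1, i => (beliefDomain n i).extend fun j : {j : I // j ≠ i} => beliefDomain n j

variable (I S) in
/-- The points of `X_i^n`. -/
abbrev DomainPt (n : ℕ) (i : I) : Type := (beliefDomain I S n i).carrier

variable (S) in
/-- Hierarchies of beliefs: `∏_n Δ(X_i^n)`; the component `t n` is the belief of order `n + 1`. -/
abbrev Hierarchy (i : I) : Type := (n : ℕ) → ProbabilityMeasure (DomainPt I S n i)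


/-! ### Coherent hierarchies and the beliefs they induce -/

/-- The projection `X_i^(n+1) → X_i^n`. -/
def lower (n : ℕ) (i : I) (x : DomainPt I S (n + 1) i) : DomainPt I S n i := Prod.fst x

theorem measurable_lower (n : ℕ) (i : I) : Measurable (lower (S := S) n i) := measurable_fst

/-- Coherency: the marginal on `X_i^n` of the next-order belief is the belief on `X_i^n`. -/
def Coherent {i : I} (t : Hierarchy S i) : Prop :=
  ∀ n, (t (n + 1)).map (measurable_lower n i).aemeasurable = t n

/-- The point of `X_i^n` described by a parameter and the hierarchies of the opponents. -/
def truncate (i : I) : (n : ℕ) → S × ((j : {j : I // j ≠ i}) → Hierarchy S j.1) → DomainPt I S n i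
  | 0, p => p.1
  | n + 1, p => (truncate i n p, fun j => p.2 j n)

theorem measurable_truncate (i : I) (n : ℕ) : Measurable (truncate (S := S) i n) := by
  induction n with
  | zero => exact measurable_fst
  | succ n ih =>
    refine Measurable.prodMk ih ?_
    exact measurable_pi_lambda _ fun j => (measurable_pi_apply n).comp
      ((measurable_pi_apply j).comp measurable_snd)

/-- `π` is a belief about the parameter and the opponents' hierarchies that preserves the
beliefs in `t`: its marginal on `X_i^n` is `t n` for every `n`. -/
def Preserves {i : I} (t : Hierarchy S i)
    (π : ProbabilityMeasure (S × ((j : {j : I // j ≠ i}) → Hierarchy S j.1))) : Prop :=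
  ∀ n, π.map (measurable_truncate i n).aemeasurable = t n

theorem exists_preserves {i : I} {t : Hierarchy S i} (ht : Coherent t) :
    ∃ π, Preserves t π := by
  let Y : ℕ → Type := fun n => (j : {j : I // j ≠ i}) → ProbabilityMeasure (DomainPt I S n j.1)
  have hY : ∀ n, StandardBorelSpace (Y n) := fun n => by
    have : ∀ j : {j : I // j ≠ i}, StandardBorelSpace (ProbabilityMeasure (DomainPt I S n j.1)) :=
      fun j => compactBorel_standardBorel (beliefDomain I S n j.1).prob
    exact StandardBorelSpace.pi_countable
  have hX : StandardBorelSpace (DomainPt I S 0 i) := compactBorel_standardBorel _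
  let e : ∀ n, DomainPt I S n i × Y n → DomainPt I S (n + 1) i := fun n p => p
  have he : ∀ n, Measurable (e n) := fun n => measurable_id
  let μ : ∀ n, Measure (DomainPt I S n i) := fun n => t n
  let ν : ∀ n, Measure (DomainPt I S n i × Y n) := fun n => (t (n + 1)).1
  have hμ : ∀ n, IsProbabilityMeasure (μ n) := fun n => (t n).2
  have hν : ∀ n, IsProbabilityMeasure (ν n) := fun n => (t (n + 1)).2
  obtain ⟨P, x, y, hP, hx, hy, hxy, hlaw⟩ :=
    exists_sequence_of_laws (fun n => DomainPt I S n i) Y e he μ ν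
      (fun n => congrArg Subtype.val (ht n)) (fun n => Measure.map_id)
  let F : (ℕ → unitInterval) → S × ((j : {j : I // j ≠ i}) → Hierarchy S j.1) :=
    fun ω => (x 0 ω, fun j n => y n ω j)
  have hF : Measurable F := by
    refine Measurable.prodMk (hx 0) (measurable_pi_lambda _ fun j => measurable_pi_lambda _ fun n => ?_)
    exact (measurable_pi_apply j).comp (hy n)
  have htr : ∀ n, truncate i n ∘ F = x n := by
    intro n
    induction n with
    | zero => rfl
    | succ n ih =>
      funext ω
      have h1 : truncate i n (F ω) = x n ω := congrFun ih ω
      change (truncate i n (F ω), y n ω) = x (n + 1) ω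
      rw [hxy, h1]
  refine ⟨⟨P.map F, Measure.isProbabilityMeasure_map hF.aemeasurable⟩, fun n => Subtype.ext ?_⟩
  change (P.map F).map (truncate i n) = _
  rw [Measure.map_map (measurable_truncate i n) hF, htr, hlaw]
  rfl

/-- The belief of a coherent hierarchy about the parameter and the opponents' hierarchies. -/
noncomputable def induced {i : I} {t : Hierarchy S i} (ht : Coherent t) :
    ProbabilityMeasure (S × ((j : {j : I // j ≠ i}) → Hierarchy S j.1)) :=
  (exists_preserves ht).choose

/-- The marginals on all `X_i^n` determine a belief. -/
theorem eq_of_truncate_eq {i : I} {V : I → Type} [mV : ∀ j, MeasurableSpace (V j)]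
    (v : (j : I) → V j → Hierarchy S j)
    (hv : ∀ j, mV j = MeasurableSpace.comap (v j) inferInstance)
    (π π' : Measure (S × ((j : {j : I // j ≠ i}) → V j.1))) [IsProbabilityMeasure π]
    [IsProbabilityMeasure π']
    (h : ∀ n, π.map (fun p => truncate i n (p.1, fun j => v j.1 (p.2 j))) =
      π'.map (fun p => truncate i n (p.1, fun j => v j.1 (p.2 j)))) : π = π' := by
  have hvm : ∀ j, Measurable (v j) := fun j => by
    rw [measurable_iff_comap_le, ← hv]
  let f : ∀ n, S × ((j : {j : I // j ≠ i}) → V j.1) → DomainPt I S n i :=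
    fun n p => truncate i n (p.1, fun j => v j.1 (p.2 j))
  have hf : ∀ n, Measurable (f n) := fun n =>
    (measurable_truncate i n).comp (measurable_fst.prodMk (measurable_pi_lambda _ fun j =>
      (hvm j.1).comp ((measurable_pi_apply j).comp measurable_snd)))
  have hlow : ∀ n, f n = lower n i ∘ f (n + 1) := fun n => rfl
  have hmono : Monotone fun n => {s | ∃ B : Set (DomainPt I S n i), MeasurableSet B ∧ f n ⁻¹' B = s} := by
    refine monotone_nat_of_le_succ fun n => ?_
    rintro _ ⟨B, hB, rfl⟩
    exact ⟨lower n i ⁻¹' B, measurable_lower n i hB, rfl⟩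
  refine ext_of_generate_finite
    (⋃ n, {s | ∃ B : Set (DomainPt I S n i), MeasurableSet B ∧ f n ⁻¹' B = s}) ?_ ?_ ?_ ?_
  · refine le_antisymm ?_ (MeasurableSpace.generateFrom_le ?_)
    · have hg : ∀ n, @Measurable _ _ (MeasurableSpace.generateFrom
          (⋃ n, {s | ∃ B : Set (DomainPt I S n i), MeasurableSet B ∧ f n ⁻¹' B = s})) _ (f n) :=
        fun n B hB => MeasurableSpace.measurableSet_generateFrom (mem_iUnion.2 ⟨n, B, hB, rfl⟩)
      refine sup_le (measurable_iff_comap_le.1 (hg 0)) (measurable_iff_comap_le.1 ?_)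
      refine @measurable_pi_lambda _ _ _ (_) _ _ fun j => ?_
      rw [measurable_iff_comap_le, hv, MeasurableSpace.comap_comp, ← measurable_iff_comap_le]
      refine @measurable_pi_lambda _ _ _ (_) _ _ fun n => ?_
      have h2 : Measurable fun q : DomainPt I S (n + 1) i =>
          (Prod.snd q : (j : {j : I // j ≠ i}) → ProbabilityMeasure (DomainPt I S n j.1)) j :=
        (measurable_pi_apply j).comp measurable_snd
      exact h2.comp (hg (n + 1))
    · intro s hs
      obtain ⟨n, B, hB, rfl⟩ := mem_iUnion.1 hs
      exact hf n hB
  · exact isPiSystem_iUnion_of_monotone _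
      (fun n =>
      @MeasurableSpace.isPiSystem_measurableSet _ (MeasurableSpace.comap (f n) inferInstance)) hmono
  · intro s hs
    obtain ⟨n, B, hB, rfl⟩ := mem_iUnion.1 hs
    rw [← Measure.map_apply (hf n) hB, ← Measure.map_apply (hf n) hB]
    exact congrFun (congrArg _ (h n)) B
  · simp

theorem induced_eq {i : I} {t : Hierarchy S i} (ht : Coherent t)
    (π : ProbabilityMeasure (S × ((j : {j : I // j ≠ i}) → Hierarchy S j.1)))
    (hπ : Preserves t π) : induced ht = π := by
  have h1 : IsProbabilityMeasure (exists_preserves ht).choose.1 := (exists_preserves ht).choose.2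
  have h2 : IsProbabilityMeasure π.1 := π.2
  refine Subtype.ext (eq_of_truncate_eq (V := fun j => Hierarchy S j) (fun j => id)
    (fun j => MeasurableSpace.comap_id.symm) (exists_preserves ht).choose.1 π.1 ?_)
  intro n
  exact congrArg Subtype.val (((exists_preserves ht).choose_spec n).trans (hπ n).symm)

/-! ### The universal type space -/

variable (S) in
/-- Coherent hierarchies with `k`-fold certainty of coherency. -/
def certainCoherent : ℕ → (i : I) → Set (Hierarchy S i)
  | 0, _ => {t | Coherent t}
  | k + 1, i => {t | ∃ ht : Coherent t,
      ∀ᵐ p ∂(induced ht).toMeasure, ∀ j : {j : I // j ≠ i}, p.2 j ∈ certainCoherent k j}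

variable (S) in
/-- The universal type set of player `i`: hierarchies that are coherent and have common
certainty of coherency. -/
def UniversalType (i : I) : Type := {t : Hierarchy S i // ∀ k, t ∈ certainCoherent S k i}

instance (i : I) : MeasurableSpace (UniversalType S i) :=
  inferInstanceAs (MeasurableSpace {t : Hierarchy S i // ∀ k, t ∈ certainCoherent S k i})

variable (S) in
/-- Profiles of types of the opponents of player `i`. -/
abbrev OpponentTypes (i : I) : Type := (j : {j : I // j ≠ i}) → UniversalType S j.1

/-- The point of `X_i^n` described by a parameter and the types of the opponents. -/
def typeTruncate (i : I) (n : ℕ) (p : S × OpponentTypes S i) : DomainPt I S n i :=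
  truncate i n (p.1, fun j => (p.2 j).1)

theorem measurable_typeTruncate (i : I) (n : ℕ) : Measurable (typeTruncate (S := S) i n) :=
  (measurable_truncate i n).comp (measurable_fst.prodMk (measurable_pi_lambda _ fun j =>
    measurable_subtype_coe.comp ((measurable_pi_apply j).comp measurable_snd)))

/-- The defining property of the belief map of the universal type space: `π` preserves the beliefs
in the hierarchy of the type `t`. -/
def IsTypeBelief {i : I} (t : UniversalType S i) (π : ProbabilityMeasure (S × OpponentTypes S i)) :
    Prop :=
  ∀ n, π.map (measurable_typeTruncate i n).aemeasurable = t.1 n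

theorem isTypeBelief_unique {i : I} {t : UniversalType S i}
    {π π' : ProbabilityMeasure (S × OpponentTypes S i)} (h : IsTypeBelief t π)
    (h' : IsTypeBelief t π') : π = π' := by
  have h1 : IsProbabilityMeasure π.1 := π.2
  have h2 : IsProbabilityMeasure π'.1 := π'.2
  refine Subtype.ext (@eq_of_truncate_eq I _ S _ _ _ _ _ i (fun j => UniversalType S j) _
    (fun j => Subtype.val) (fun j => rfl) π.1 π'.1 h1 h2 ?_)
  intro n
  exact congrArg Subtype.val ((h n).trans (h' n).symm)

theorem exists_isTypeBelief {i : I} (t : UniversalType S i) : ∃ π, IsTypeBelief t π := by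
  have ht : Coherent t.1 := t.2 0
  have hae : ∀ᵐ p ∂(induced ht).toMeasure,
      ∀ (j : {j : I // j ≠ i}) (k : ℕ), p.2 j ∈ certainCoherent S k j.1 := by
    have : ∀ k, ∀ᵐ p ∂(induced ht).toMeasure,
        ∀ j : {j : I // j ≠ i}, p.2 j ∈ certainCoherent S k j.1 := fun k => (t.2 (k + 1)).2
    filter_upwards [ae_all_iff.2 this] with p hp j k using hp k j
  let emb : S × OpponentTypes S i → S × ((j : {j : I // j ≠ i}) → Hierarchy S j.1) :=
    fun p => (p.1, fun j => (p.2 j).1)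
  have hemb : Measurable emb := measurable_fst.prodMk (measurable_pi_lambda _ fun j =>
    measurable_subtype_coe.comp ((measurable_pi_apply j).comp measurable_snd))
  have hinj : Function.Injective emb := by
    intro p q h
    refine Prod.ext (Prod.ext_iff.1 h).1 (funext fun j => Subtype.ext ?_)
    exact congrFun (Prod.ext_iff.1 h).2 j
  have hrange : ∀ᵐ p ∂(induced ht).toMeasure, p ∈ range emb := by
    filter_upwards [hae] with p hp
    exact ⟨(p.1, fun j => ⟨p.2 j, hp j⟩), rfl⟩
  have hms : ∀ s : Set (S × OpponentTypes S i), MeasurableSet s →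
      ∃ B, MeasurableSet B ∧ emb ⁻¹' B = s := by
    have : (inferInstance : MeasurableSpace (S × OpponentTypes S i)) ≤
        MeasurableSpace.comap emb inferInstance := by
      have h1 : @Measurable _ _ (MeasurableSpace.comap emb inferInstance) _ emb :=
        comap_measurable emb
      have h2 := measurable_fst.comp h1
      have h3 := measurable_snd.comp h1
      refine sup_le (measurable_iff_comap_le.1 h2) (measurable_iff_comap_le.1 ?_)
      refine @measurable_pi_lambda _ _ _ (_) _ _ fun j => ?_
      refine @Measurable.subtype_mk _ _ (_) _ _ (fun p => (emb p).2 j) ?_ _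
      exact (measurable_pi_apply j).comp h3
    exact fun s hs => this s hs
  have himg : ∀ s : Set (S × OpponentTypes S i), MeasurableSet s →
      NullMeasurableSet (emb '' s) (induced ht).toMeasure := by
    intro s hs
    obtain ⟨B, hB, rfl⟩ := hms s hs
    rw [image_preimage_eq_inter_range]
    exact hB.nullMeasurableSet.inter (NullMeasurableSet.of_compl
      (NullMeasurableSet.of_null hrange))
  have hmap : ((induced ht).toMeasure.comap emb).map emb = (induced ht).toMeasure := by
    ext B hB
    rw [Measure.map_apply hemb hB, Measure.comap_apply₀ emb _ hinj himg
      (hemb hB).nullMeasurableSet, image_preimage_eq_inter_range]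
    refine measure_congr ?_
    filter_upwards [hrange] with p hp
    exact propext ⟨fun h => h.1, fun h => ⟨h, hp⟩⟩
  have hprob : IsProbabilityMeasure ((induced ht).toMeasure.comap emb) := by
    refine ⟨?_⟩
    have h1 : ((induced ht).toMeasure.comap emb).map emb univ = 1 := by
      rw [hmap]
      exact measure_univ
    rwa [Measure.map_apply hemb MeasurableSet.univ, preimage_univ] at h1
  refine ⟨⟨_, hprob⟩, fun n => Subtype.ext ?_⟩
  have h2 : ((induced ht).toMeasure.comap emb).map (truncate i n ∘ emb) = (t.1 n).toMeasure := by
    rw [← Measure.map_map (measurable_truncate i n) hemb, hmap]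
    exact congrArg Subtype.val ((exists_preserves ht).choose_spec n)
  exact h2

/-- The belief map `κ*` of the universal type space. -/
noncomputable def typeBelief {i : I} (t : UniversalType S i) :
    ProbabilityMeasure (S × OpponentTypes S i) :=
  (exists_isTypeBelief t).choose

/-- The first-order belief `marg_S κ*(t)` of a type. -/
noncomputable def firstOrderBelief {i : I} (t : UniversalType S i) : ProbabilityMeasure S :=
  (typeBelief t).map measurable_fst.aemeasurable

/-- The types with `k + 1`-fold certainty that first-order beliefs lie in `𝓑`. -/
def certainBelief (𝓑 : Set (ProbabilityMeasure S)) : ℕ → (i : I) → Set (UniversalType S i)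
  | 0, _ => {t | firstOrderBelief t ∈ 𝓑}
  | k + 1, i => {t | ∀ᵐ p ∂(typeBelief t).toMeasure,
      ∀ j : {j : I // j ≠ i}, p.2 j ∈ certainBelief 𝓑 k j}

/-- `T_i^𝓑`: the types with common certainty that all players' first-order beliefs lie in `𝓑`. -/
def commonCertainty (𝓑 : Set (ProbabilityMeasure S)) (i : I) : Set (UniversalType S i) :=
  ⋂ k, certainBelief 𝓑 k i

/-! ### The limiting type -/

/-- The point of `X_i^n` at which the parameter is `θ` and every belief is a point mass at the
corresponding point. -/
noncomputable def limitPoint (θ : S) : (n : ℕ) → (i : I) → DomainPt I S n i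
  | 0, _ => θ
  | n + 1, i => (limitPoint θ n i, fun j => diracProba (limitPoint θ n j.1))

/-- The hierarchy of complete information about `θ`. -/
noncomputable def limitHierarchy (θ : S) (i : I) : Hierarchy S i :=
  fun n => diracProba (limitPoint θ n i)

theorem coherent_limitHierarchy (θ : S) (i : I) : Coherent (limitHierarchy θ i) :=
  fun n => Subtype.ext (Measure.map_dirac' (measurable_lower n i) (limitPoint θ (n + 1) i))

theorem truncate_limitHierarchy (θ : S) (i : I) (n : ℕ) :
    truncate i n (θ, fun j => limitHierarchy θ j.1) = limitPoint θ n i := by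
  induction n with
  | zero => rfl
  | succ n ih => exact Prod.ext ih rfl

instance (i : I) : MeasurableSingletonClass (Hierarchy S i) := by
  have : ∀ n, StandardBorelSpace (ProbabilityMeasure (DomainPt I S n i)) := fun n =>
    compactBorel_standardBorel (beliefDomain I S n i).prob
  infer_instance

theorem induced_limitHierarchy (θ : S) (i : I) :
    induced (coherent_limitHierarchy θ i) = diracProba (θ, fun j : {j : I // j ≠ i} => limitHierarchy θ j.1) := by
  refine induced_eq _ _ fun n => Subtype.ext ?_
  refine (Measure.map_dirac' (measurable_truncate i n) _).trans ?_
  rw [truncate_limitHierarchy]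
  rfl

theorem limitHierarchy_mem (θ : S) (k : ℕ) (i : I) :
    limitHierarchy θ i ∈ certainCoherent S k i := by
  induction k generalizing i with
  | zero => exact coherent_limitHierarchy θ i
  | succ k ih =>
    refine ⟨coherent_limitHierarchy θ i, ?_⟩
    rw [induced_limitHierarchy]
    change ∀ᵐ p ∂(Measure.dirac _), _
    rw [ae_dirac_eq]
    exact fun j => ih j.1

/-- `t_i^∞` for the limiting belief `δ_θ`: the type with common certainty that every player's
first-order belief is the point mass at `θ`. -/
noncomputable def limitType (θ : S) (i : I) : UniversalType S i :=
  ⟨limitHierarchy θ i, fun k => limitHierarchy_mem θ k i⟩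

theorem typeBelief_limitType (θ : S) (i : I) :
    typeBelief (limitType θ i) = diracProba (θ, fun j : {j : I // j ≠ i} => limitType θ j.1) := by
  refine isTypeBelief_unique (exists_isTypeBelief _).choose_spec fun n => Subtype.ext ?_
  refine (Measure.map_dirac' (measurable_typeTruncate i n) _).trans ?_
  exact congrArg Measure.dirac (truncate_limitHierarchy θ i n)

theorem limitType_mem_commonCertainty (θ : S) (i : I) :
    limitType θ i ∈ commonCertainty {diracProba θ} i := by
  refine mem_iInter.2 fun k => ?_
  induction k generalizing i with
  | zero =>
    refine Subtype.ext ?_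
    change (typeBelief (limitType θ i)).toMeasure.map Prod.fst = _
    rw [typeBelief_limitType]
    exact Measure.map_dirac' measurable_fst _
  | succ k ih =>
    have : ∀ j : I, MeasurableSingletonClass (UniversalType S j) := fun j => inferInstanceAs
      (MeasurableSingletonClass {t : Hierarchy S j // ∀ k, t ∈ certainCoherent S k j})
    change ∀ᵐ p ∂(typeBelief (limitType θ i)).toMeasure, _
    rw [typeBelief_limitType]
    change ∀ᵐ p ∂(Measure.dirac _), _
    rw [ae_dirac_eq]
    exact fun j => ih j.1

end TypeSpace

section Games

variable {I : Type} [Finite I] {S : Type} [TopologicalSpace S] [CompactSpace S]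
  [TopologicalSpace.MetrizableSpace S] [MeasurableSpace S] [BorelSpace S]
  {A : I → Type} [∀ j, MeasurableSpace (A j)]

/-! ### Games and rationalizability -/

/-- `U = ℝ^{|I| × |A|}`: the payoff of each player at each action profile. -/
abbrev Payoffs (I : Type) (A : I → Type) : Type := I × ((j : I) → A j) → ℝ

/-- Action profiles of the opponents of player `i`. -/
abbrev OpponentActions (A : I → Type) (i : I) : Type := (j : {j : I // j ≠ i}) → A j.1

open Classical in
/-- The action profile `(a_i, a_{-i})`. -/
noncomputable def profile {i : I} (a : A i) (b : OpponentActions A i) : (j : I) → A j :=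
  fun j => if h : j = i then cast (congrArg A h.symm) a else b ⟨j, h⟩

/-- The payoff `u_i(a_i, a_{-i}, θ)`, for `g : Θ → U`. -/
noncomputable def payoff (g : S → Payoffs I A) {i : I} (a : A i) (b : OpponentActions A i)
    (θ : S) : ℝ :=
  g θ (i, profile a b)

/-- The expected payoff of `a` under `π ∈ Δ(Θ × T_{-i} × A_{-i})`. -/
noncomputable def expectedPayoff (g : S → Payoffs I A) {i : I} (a : A i)
    (π : ProbabilityMeasure ((S × OpponentTypes S i) × OpponentActions A i)) : ℝ :=
  ∫ p, payoff g a p.2 p.1.1 ∂π.toMeasure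

/-- `a` is a best reply to `π`. -/
def IsBestReply (g : S → Payoffs I A) (i : I) (a : A i)
    (π : ProbabilityMeasure ((S × OpponentTypes S i) × OpponentActions A i)) : Prop :=
  ∀ a' : A i, expectedPayoff g a' π ≤ expectedPayoff g a π

/-- `a` is a strict best reply to `π`. -/
def IsStrictBestReply (g : S → Payoffs I A) (i : I) (a : A i)
    (π : ProbabilityMeasure ((S × OpponentTypes S i) × OpponentActions A i)) : Prop :=
  ∀ a' : A i, a' ≠ a → expectedPayoff g a' π < expectedPayoff g a π

/-- The sets `S_i^k[t]` of actions of type `t` that survive `k` rounds of elimination, where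
`reply i a π` says that `a` is a reply of the required kind to the conjecture `π`. -/
def survivors (reply : (i : I) → A i →
      ProbabilityMeasure ((S × OpponentTypes S i) × OpponentActions A i) → Prop) :
    ℕ → (i : I) → UniversalType S i → Set (A i)
  | 0, _, _ => univ
  | k + 1, i, t => {a | ∃ π : ProbabilityMeasure ((S × OpponentTypes S i) × OpponentActions A i),
      π.map measurable_fst.aemeasurable = typeBelief t ∧
      (∀ᵐ p ∂π.toMeasure, ∀ j : {j : I // j ≠ i}, p.2 j ∈ survivors reply k j.1 (p.1.2 j)) ∧
      reply i a π}

/-- `a` is (interim correlated) rationalizable for type `t`. -/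
def IsRationalizable (g : S → Payoffs I A) {i : I} (t : UniversalType S i) (a : A i) : Prop :=
  ∀ k, a ∈ survivors (IsBestReply g) k i t

/-- `a` is strictly rationalizable for type `t`. -/
def IsStrictlyRationalizable (g : S → Payoffs I A) {i : I} (t : UniversalType S i) (a : A i) :
    Prop :=
  ∀ k, a ∈ survivors (IsStrictBestReply g) k i t

/-- The `δ`-strict best reply property of a family of sets `R_i[t] ⊆ A_i`: every `a ∈ R_i[t]` is
a `δ`-strict best reply for `t` to some conjecture `σ : Θ × T_{-i} → Δ(A_{-i})` under which the
opponents play actions in `R_{-i}[t_{-i}]`. -/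
def StrictBestReplyProperty (g : S → Payoffs I A) (δ : ℝ)
    (R : (i : I) → UniversalType S i → Set (A i)) : Prop :=
  ∀ (i : I) (t : UniversalType S i), ∀ a ∈ R i t,
    ∃ σ : Kernel (S × OpponentTypes S i) (OpponentActions A i), IsMarkovKernel σ ∧
      (∀ᵐ p ∂(typeBelief t).toMeasure, ∀ᵐ b ∂(σ p),
        ∀ j : {j : I // j ≠ i}, b j ∈ R j.1 (p.2 j)) ∧
      ∀ a' : A i, a' ≠ a →
        δ ≤ (∫ p, (∫ b, payoff g a b p.1 ∂(σ p)) ∂(typeBelief t).toMeasure) -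
          ∫ p, (∫ b, payoff g a' b p.1 ∂(σ p)) ∂(typeBelief t).toMeasure

/-- `a` is `δ`-strictly rationalizable for type `t`. -/
def IsDeltaStrictlyRationalizable (g : S → Payoffs I A) (δ : ℝ) {i : I} (t : UniversalType S i)
    (a : A i) : Prop :=
  ∃ R : (i : I) → UniversalType S i → Set (A i), StrictBestReplyProperty g δ R ∧ a ∈ R i t

/-- The supremum, in `[0, ∞]`, of all `δ` such that `a` is `δ`-strictly rationalizable for `t`. -/
noncomputable def strictness (g : S → Payoffs I A) {i : I} (t : UniversalType S i) (a : A i) :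
    ℝ≥0∞ :=
  ⨆ (δ : ℝ) (_ : IsDeltaStrictlyRationalizable g δ t a), ENNReal.ofReal δ

/-- `a` is strongly `𝓑`-rationalizable: rationalizable for every type in `T_i^𝓑`. -/
def IsStronglyRationalizable (g : S → Payoffs I A) (𝓑 : Set (ProbabilityMeasure S)) {i : I}
    (a : A i) : Prop :=
  ∀ t ∈ commonCertainty 𝓑 i, IsRationalizable g t a

/-! ### Data and learning rules -/

/-- Learning rules map every data set `(z_1, …, z_n)` to a belief; the value at the empty data set
plays no role. -/
abbrev LearningRule (Z S : Type) [MeasurableSpace S] : Type :=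
  (n : ℕ) → (Fin n → Z) → ProbabilityMeasure S

/-- The set `𝓑(z_n)` of plausible beliefs. -/
def plausibleBeliefs {Z : Type} (M : Set (LearningRule Z S)) {n : ℕ} (z : Fin n → Z) :
    Set (ProbabilityMeasure S) :=
  {ν | ∃ μ ∈ M, μ n z = ν}

/-- The set `𝓒(z_n)`: the union of the supports of the plausible beliefs. -/
def plausibleSupport {Z : Type} (M : Set (LearningRule Z S)) {n : ℕ} (z : Fin n → Z) : Set S :=
  ⋃ μ ∈ M, (μ n z).toMeasure.support

/-- The first `n` observations of a sample path. -/
def initialData {Z : Type} (n : ℕ) (z : ℕ → Z) : Fin n → Z := fun k => z k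

/-- `P^n`: the law of the first `n` observations under `P`. -/
noncomputable def dataLaw {Z : Type} [MeasurableSpace Z] (P : Measure (ℕ → Z)) (n : ℕ) :
    Measure (Fin n → Z) :=
  P.map (initialData n)

/-- The lower probability `p̲^n(a)`. -/
noncomputable def lowerConfidence {Z : Type} [MeasurableSpace Z] (g : S → Payoffs I A)
    (P : Measure (ℕ → Z)) (M : Set (LearningRule Z S)) (n : ℕ) {i : I} (a : A i) : ℝ≥0∞ :=
  dataLaw P n {z | IsStronglyRationalizable g (plausibleBeliefs M z) a}

/-- `sup_{θ ∈ 𝓒(z_n)} ‖θ - θ₀‖_∞`. -/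
noncomputable def supportRadius {d : ℕ} {Θ : Set (Fin d → ℝ)} {Z : Type}
    (M : Set (LearningRule Z Θ)) (θ₀ : Θ) {n : ℕ} (z : Fin n → Z) : ℝ≥0∞ :=
  ⨆ θ ∈ plausibleSupport M z, ‖(θ : Fin d → ℝ) - (θ₀ : Fin d → ℝ)‖ₑ

end Games

end LearningGames

open LearningGames

/-!
At the limit type everything is certain: its belief is the point mass at `θ₀` and the opponents'
limit types. Conjectures therefore reduce to laws `ν` of the opponents' actions.

*Positivity.* The strictly surviving sets of the limit types decrease with the number of rounds and
live in finite action sets, so they stabilize. The stable sets, extended by `∅` to all other types,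
have a strict best reply property; only finitely many payoff differences are involved, so some
`δ > 0` bounds all of them from below (`strictness_limitType_pos`).

*The bound.* Let `a` be `δ`-strictly rationalizable for the limit type, with `R` as witness, and
suppose that almost surely under each belief in `𝓑` the payoffs are within `ε ≤ δ / 2` of those at
`θ₀`. For every type with common certainty of `𝓑`, the conjecture under which the opponents play
according to `ν` whatever the state and their types changes each expected payoff by at most `ε`, so
actions that are `δ`-strict replies at the limit type remain best replies. Types with common
certainty of `𝓑` believe that the opponents are such types, so by induction the actions in
`R_i[t_i^∞]` survive every round at all of them (`isStronglyRationalizable_of_abs_sub_le`). The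
Lipschitz condition makes this applicable with `ε = K r` whenever `2 K r < δ^∞`, where `r` is the
radius of the plausible support, and Markov's inequality for `r` gives the bound.
-/

namespace LearningGames

section Games

variable {I : Type} [Finite I] {S : Type} [TopologicalSpace S] [CompactSpace S]
  [TopologicalSpace.MetrizableSpace S] [MeasurableSpace S] [BorelSpace S]
  {A : I → Type} [∀ j, MeasurableSpace (A j)]

instance (j : I) : MeasurableSingletonClass (UniversalType S j) :=
  inferInstanceAs (MeasurableSingletonClass {t : Hierarchy S j // ∀ k, t ∈ certainCoherent S k j})

theorem toMeasure_typeBelief_limitType (θ : S) (i : I) :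
    (typeBelief (limitType θ i)).toMeasure =
      Measure.dirac (θ, fun j : {j : I // j ≠ i} => limitType θ j.1) := by
  rw [typeBelief_limitType]
  rfl

/-! ### Payoffs -/

theorem integrable_payoff [∀ j, Finite (A j)] [∀ j, DiscreteMeasurableSpace (A j)]
    {g : S → Payoffs I A} (hg : Continuous g) {i : I} (a : A i)
    (π : Measure ((S × OpponentTypes S i) × OpponentActions A i)) [IsFiniteMeasure π] :
    Integrable (fun p => payoff g a p.2 p.1.1) π := by
  have hc : ∀ b : OpponentActions A i, Continuous (payoff g a b) := fun b =>
    (continuous_apply _).comp hg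
  have hm : Measurable fun p : (S × OpponentTypes S i) × OpponentActions A i =>
      payoff g a p.2 p.1.1 :=
    measurable_from_prod_countable_left fun b =>
      (hc b).measurable.comp measurable_fst
  have hb : ∀ b : OpponentActions A i, ∃ C, ∀ θ, ‖payoff g a b θ‖ ≤ C := fun b => by
    obtain ⟨C, hC⟩ := isCompact_univ.exists_bound_of_continuousOn (hc b).continuousOn
    exact ⟨C, fun θ => hC θ (mem_univ θ)⟩
  choose C hC using hb
  obtain ⟨D, hD⟩ := (finite_range C).bddAbove
  exact Integrable.of_bound hm.aestronglyMeasurable D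
    (Eventually.of_forall fun p => (hC p.2 p.1.1).trans (hD (mem_range_self p.2)))

/-- If the payoffs are almost surely `ε`-close to those at `θ₀`, then so are the expected payoffs
against opponents whose actions have law `ν` independently of everything else. -/
theorem abs_expectedPayoff_prod_sub_le [∀ j, Finite (A j)] [∀ j, DiscreteMeasurableSpace (A j)]
    {g : S → Payoffs I A} (hg : Continuous g) {i : I} (a : A i) {θ₀ : S} {ε : ℝ}
    (κ : ProbabilityMeasure (S × OpponentTypes S i))
    (hκ : ∀ᵐ p ∂κ.toMeasure, ∀ x, |g p.1 x - g θ₀ x| ≤ ε)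
    (ν : ProbabilityMeasure (OpponentActions A i)) :
    |expectedPayoff g a (κ.prod ν) - ∫ b, payoff g a b θ₀ ∂ν.toMeasure| ≤ ε := by
  have hν : ∫ b, payoff g a b θ₀ ∂ν.toMeasure =
      ∫ p, payoff g a p.2 θ₀ ∂(κ.toMeasure.prod ν.toMeasure) := by
    rw [integral_fun_snd (μ := κ.toMeasure) (ν := ν.toMeasure) fun b => payoff g a b θ₀]
    simp
  have hint : Integrable (fun p : (S × OpponentTypes S i) × OpponentActions A i =>
      payoff g a p.2 θ₀) (κ.toMeasure.prod ν.toMeasure) :=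
    Integrable.comp_snd (f := fun b => payoff g a b θ₀) .of_finite κ.toMeasure
  have hexp : expectedPayoff g a (κ.prod ν) =
      ∫ p, payoff g a p.2 p.1.1 ∂(κ.toMeasure.prod ν.toMeasure) := rfl
  rw [hexp, hν, ← integral_sub (integrable_payoff hg a _) hint]
  have h := norm_integral_le_of_norm_le_const (μ := κ.toMeasure.prod ν.toMeasure) (C := ε)
    (f := fun p => payoff g a p.2 p.1.1 - payoff g a p.2 θ₀)
    ((Measure.quasiMeasurePreserving_fst.ae hκ).mono fun p hp => hp _)
  simpa using h

/-! ### Rationalizability near the limit type -/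

/-- At the limit type, the `δ`-strict best reply property yields a law of the opponents' actions
against which the action is a `δ`-strict reply under the payoffs at `θ`. -/
theorem StrictBestReplyProperty.exists_law_of_mem_limitType {g : S → Payoffs I A} {δ : ℝ}
    {R : (i : I) → UniversalType S i → Set (A i)} (hR : StrictBestReplyProperty g δ R) (θ : S)
    {i : I} {a : A i} (ha : a ∈ R i (limitType θ i)) :
    ∃ ν : ProbabilityMeasure (OpponentActions A i),
      (∀ᵐ b ∂ν.toMeasure, ∀ j : {j : I // j ≠ i}, b j ∈ R j.1 (limitType θ j.1)) ∧
      ∀ a' : A i, a' ≠ a →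
        δ ≤ ∫ b, payoff g a b θ ∂ν.toMeasure - ∫ b, payoff g a' b θ ∂ν.toMeasure := by
  obtain ⟨σ, hσ, hsupp, hreply⟩ := hR i _ a ha
  rw [toMeasure_typeBelief_limitType, ae_dirac_eq] at hsupp
  refine ⟨⟨σ (θ, fun j => limitType θ j.1), inferInstance⟩, hsupp, fun a' ha' => ?_⟩
  have h := hreply a' ha'
  rwa [toMeasure_typeBelief_limitType, integral_dirac, integral_dirac] at h

theorem ae_mem_commonCertainty {𝓑 : Set (ProbabilityMeasure S)} {i : I} {t : UniversalType S i}
    (ht : t ∈ commonCertainty 𝓑 i) :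
    ∀ᵐ p ∂(typeBelief t).toMeasure,
      ∀ j : {j : I // j ≠ i}, p.2 j ∈ commonCertainty 𝓑 j.1 := by
  have h : ∀ k, ∀ᵐ p ∂(typeBelief t).toMeasure,
      ∀ j : {j : I // j ≠ i}, p.2 j ∈ certainBelief 𝓑 k j.1 := fun k => mem_iInter.1 ht (k + 1)
  filter_upwards [ae_all_iff.2 h] with p hp j using mem_iInter.2 fun k => hp k j

/-- An action that is `δ`-strictly rationalizable at the limit type is rationalizable for all types
with common certainty of beliefs under which payoffs move by at most `δ / 2`. The induction on
rounds is over all actions in the witnessing sets of the limit types at once. -/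
theorem isStronglyRationalizable_of_abs_sub_le [∀ j, Finite (A j)]
    [∀ j, DiscreteMeasurableSpace (A j)] {g : S → Payoffs I A} (hg : Continuous g) {θ₀ : S}
    {ε δ : ℝ} (hεδ : 2 * ε ≤ δ) {𝓑 : Set (ProbabilityMeasure S)}
    (h𝓑 : ∀ ν ∈ 𝓑, ∀ᵐ θ ∂ν.toMeasure, ∀ x, |g θ x - g θ₀ x| ≤ ε) {i : I} {a : A i}
    (ha : IsDeltaStrictlyRationalizable g δ (limitType θ₀ i) a) :
    IsStronglyRationalizable g 𝓑 a := by
  obtain ⟨R, hR, haR⟩ := ha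
  suffices h : ∀ (k : ℕ) (j : I), ∀ t ∈ commonCertainty 𝓑 j, ∀ b ∈ R j (limitType θ₀ j),
      b ∈ survivors (IsBestReply g) k j t from fun t ht k => h k i t ht a haR
  intro k
  induction k with
  | zero => exact fun j t _ b _ => mem_univ b
  | succ k ih =>
    intro j t ht b hb
    obtain ⟨ν, hν, hreply⟩ := hR.exists_law_of_mem_limitType θ₀ hb
    have hfirst : ∀ᵐ p ∂(typeBelief t).toMeasure, ∀ x, |g p.1 x - g θ₀ x| ≤ ε :=
      ae_of_ae_map measurable_fst.aemeasurable (h𝓑 _ (mem_iInter.1 ht 0))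
    refine ⟨(typeBelief t).prod ν, ProbabilityMeasure.map_fst_prod _ _, ?_, fun b' => ?_⟩
    · change ∀ᵐ p ∂((typeBelief t).toMeasure.prod ν.toMeasure), _
      filter_upwards [Measure.quasiMeasurePreserving_fst.ae (ae_mem_commonCertainty ht),
        Measure.quasiMeasurePreserving_snd.ae hν] with p hp hp' l
      exact ih l.1 _ (hp l) _ (hp' l)
    · rcases eq_or_ne b' b with rfl | hb'
      · exact le_rfl
      · have h1 := abs_le.1 (abs_expectedPayoff_prod_sub_le hg b _ hfirst ν)
        have h2 := abs_le.1 (abs_expectedPayoff_prod_sub_le hg b' _ hfirst ν)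
        linarith [hreply b' hb', h1.1, h2.2]

/-! ### Positivity of the strictness -/

theorem exists_pos_forall_le {α : Type*} [Finite α] {f : α → ℝ} (hf : ∀ x, 0 < f x) :
    ∃ ε > 0, ∀ x, ε ≤ f x := by
  cases isEmpty_or_nonempty α
  · exact ⟨1, one_pos, isEmptyElim⟩
  · obtain ⟨x, hx⟩ := Finite.exists_min f
    exact ⟨f x, hf x, hx⟩

theorem antitone_survivors (reply : (i : I) → A i →
      ProbabilityMeasure ((S × OpponentTypes S i) × OpponentActions A i) → Prop) :
    Antitone (survivors reply) := by
  refine antitone_nat_of_succ_le fun k => ?_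
  induction k with
  | zero => exact fun i t => subset_univ _
  | succ k ih =>
    rintro i t a ⟨π, hπ, hsupp, hreply⟩
    exact ⟨π, hπ, hsupp.mono fun p hp j => ih j.1 _ (hp j), hreply⟩

/-- At the limit type, a strict best reply to a conjecture is a `δ`-strict reply, for some `δ > 0`,
to the law of the opponents' actions under that conjecture. -/
theorem exists_law_of_mem_survivors_limitType [∀ j, Finite (A j)]
    [∀ j, DiscreteMeasurableSpace (A j)] {g : S → Payoffs I A} {θ : S} {k : ℕ} {i : I} {a : A i}
    (ha : a ∈ survivors (IsStrictBestReply g) (k + 1) i (limitType θ i)) :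
    ∃ ν : ProbabilityMeasure (OpponentActions A i),
      (∀ᵐ b ∂ν.toMeasure, ∀ j : {j : I // j ≠ i},
        b j ∈ survivors (IsStrictBestReply g) k j.1 (limitType θ j.1)) ∧
      ∃ δ > 0, ∀ a' : A i, a' ≠ a →
        δ ≤ ∫ b, payoff g a b θ ∂ν.toMeasure - ∫ b, payoff g a' b θ ∂ν.toMeasure := by
  obtain ⟨π, hπ, hsupp, hreply⟩ := ha
  have hfst : ∀ᵐ p ∂π.toMeasure, p.1 = (θ, fun j : {j : I // j ≠ i} => limitType θ j.1) := by
    have h : π.toMeasure.map Prod.fst =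
        Measure.dirac (θ, fun j : {j : I // j ≠ i} => limitType θ j.1) :=
      (congrArg Subtype.val hπ).trans (toMeasure_typeBelief_limitType θ i)
    refine ae_of_ae_map (p := fun q => q = _) measurable_fst.aemeasurable ?_
    rw [h, ae_dirac_eq]
    rfl
  let ν : ProbabilityMeasure (OpponentActions A i) := π.map measurable_snd.aemeasurable
  have hν : ν.toMeasure = π.toMeasure.map Prod.snd := rfl
  have hpay : ∀ a' : A i, expectedPayoff g a' π = ∫ b, payoff g a' b θ ∂ν.toMeasure := by
    intro a'
    rw [hν, integral_map measurable_snd.aemeasurable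
      (StronglyMeasurable.of_discrete).aestronglyMeasurable]
    refine integral_congr_ae (hfst.mono fun p hp => ?_)
    simp only [hp]
  refine ⟨ν, ?_, ?_⟩
  · rw [hν, ae_map_iff measurable_snd.aemeasurable (MeasurableSet.of_discrete)]
    filter_upwards [hsupp, hfst] with p hp hp' j
    have h := hp j
    rwa [hp'] at h
  · obtain ⟨δ, hδ, h⟩ := exists_pos_forall_le fun a' : {a' : A i // a' ≠ a} =>
      sub_pos.2 (hreply a'.1 a'.2)
    refine ⟨δ, hδ, fun a' ha' => ?_⟩
    rw [← hpay, ← hpay]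
    exact h ⟨a', ha'⟩

/-- Uniformity in `δ` is obtained from the finiteness of the stable sets, since a strict best reply
property without a common margin would say nothing about the strictness. -/
theorem strictness_limitType_pos [∀ j, Finite (A j)] [∀ j, DiscreteMeasurableSpace (A j)]
    {g : S → Payoffs I A} {θ : S} {i : I} {a : A i}
    (ha : IsStrictlyRationalizable g (limitType θ i) a) : 0 < strictness g (limitType θ i) a := by
  let D : ℕ → (j : I) → Set (A j) := fun k j =>
    survivors (IsStrictBestReply g) k j (limitType θ j)
  have hD : Antitone D := fun k l hkl j => antitone_survivors _ hkl j _
  obtain ⟨N, hN⟩ := WellFoundedGT.monotone_chain_condition (α := ((j : I) → Set (A j))ᵒᵈ)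
    ⟨fun k => OrderDual.toDual (D k), hD⟩
  have hstep : ∀ x : (j : I) × D N j, ∃ ν : ProbabilityMeasure (OpponentActions A x.1),
      (∀ᵐ b ∂ν.toMeasure, ∀ j : {j : I // j ≠ x.1}, b j ∈ D N j.1) ∧
      ∃ δ > 0, ∀ a' : A x.1, a' ≠ x.2 →
        δ ≤ ∫ b, payoff g x.2.1 b θ ∂ν.toMeasure - ∫ b, payoff g a' b θ ∂ν.toMeasure := by
    rintro ⟨j, b, hb⟩
    have h : D N = D (N + 1) := hN (N + 1) N.le_succ
    rw [h] at hb
    exact exists_law_of_mem_survivors_limitType hb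
  choose ν hν δ hδ hreply using hstep
  obtain ⟨ε, hε, hεδ⟩ := exists_pos_forall_le hδ
  -- Empty sets away from the limit types suffice: a limit type is certain of limit types only.
  have haε : IsDeltaStrictlyRationalizable g ε (limitType θ i) a := by
    refine ⟨fun j t => {b | t = limitType θ j ∧ b ∈ D N j}, ?_, rfl, ha N⟩
    rintro j t b ⟨rfl, hb⟩
    refine ⟨Kernel.const _ (ν ⟨j, b, hb⟩).toMeasure, inferInstance, ?_, fun a' ha' => ?_⟩
    · rw [toMeasure_typeBelief_limitType, ae_dirac_eq]
      exact (hν ⟨j, b, hb⟩).mono fun c hc l => ⟨rfl, hc l⟩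
    · rw [toMeasure_typeBelief_limitType, integral_dirac, integral_dirac]
      exact (hεδ ⟨j, b, hb⟩).trans (hreply ⟨j, b, hb⟩ a' ha')
  exact (ENNReal.ofReal_pos.2 hε).trans_le (le_iSup₂_of_le ε haε le_rfl)

end Games

/-! ### Learning -/

section Learning

variable {I : Type} [Fintype I] [DecidableEq I] {A : I → Type} [∀ j, Fintype (A j)]
  [∀ j, MeasurableSpace (A j)] [∀ j, DiscreteMeasurableSpace (A j)] {d : ℕ}
  {Θ : Set (Fin d → ℝ)} {Z : Type}

theorem edist_le_supportRadius {M : Set (LearningRule Z Θ)} {n : ℕ} {z : Fin n → Z} {θ : Θ}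
    (θ₀ : Θ) (hθ : θ ∈ plausibleSupport M z) : edist θ θ₀ ≤ supportRadius M θ₀ z := by
  refine le_trans (le_of_eq ?_) (le_iSup₂_of_le θ hθ le_rfl)
  rw [Subtype.edist_eq, edist_eq_enorm_sub]

theorem supportRadius_lt_top [CompactSpace Θ] (M : Set (LearningRule Z Θ)) (θ₀ : Θ) {n : ℕ}
    (z : Fin n → Z) :
    supportRadius M θ₀ z < ⊤ := by
  have h : Metric.ediam (univ : Set Θ) < ⊤ := 
    (Bornology.IsBounded.ediam_ne_top isCompact_univ.isBounded).lt_top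
  refine lt_of_le_of_lt (iSup₂_le fun θ _ => ?_) h
  rw [← edist_eq_enorm_sub, ← Subtype.edist_eq]
  exact Metric.edist_le_ediam_of_mem (mem_univ θ) (mem_univ θ₀)

/-- Every plausible belief is concentrated on the plausible support. -/
theorem ae_mem_plausibleSupport {M : Set (LearningRule Z Θ)} {n : ℕ} {z : Fin n → Z}
    {ν : ProbabilityMeasure Θ} (hν : ν ∈ plausibleBeliefs M z) :
    ∀ᵐ θ ∂ν.toMeasure, θ ∈ plausibleSupport M z := by
  obtain ⟨μ, hμ, rfl⟩ := hν
  filter_upwards [Measure.support_mem_ae (μ := (μ n z).toMeasure)] with θ hθ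
  exact mem_biUnion hμ hθ

/-- A data set whose plausible support has radius less than `δ^∞ / (2 K)` makes the action strongly
rationalizable. -/
theorem isStronglyRationalizable_of_lt_strictness [CompactSpace Θ] {g : Θ → Payoffs I A} {K : ℝ≥0}
    (hK : LipschitzWith K g) {M : Set (LearningRule Z Θ)} {θ₀ : Θ} {n : ℕ} {z : Fin n → Z} {i : I}
    {a : A i} (hz : 2 * (K : ℝ≥0∞) * supportRadius M θ₀ z < strictness g (limitType θ₀ i) a) :
    IsStronglyRationalizable g (plausibleBeliefs M z) a := by
  obtain ⟨δ, hδ⟩ := lt_iSup_iff.1 hz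
  obtain ⟨ha, hδ⟩ := lt_iSup_iff.1 hδ
  have hr := supportRadius_lt_top M θ₀ z
  refine isStronglyRationalizable_of_abs_sub_le (ε := K * (supportRadius M θ₀ z).toReal)
    hK.continuous ?_ (fun ν hν => (ae_mem_plausibleSupport hν).mono fun θ hθ x => ?_) ha
  · have h := (ENNReal.lt_ofReal_iff_toReal_lt
      (ENNReal.mul_ne_top (ENNReal.mul_ne_top (by simp) (by simp)) hr.ne)).1 hδ
    rw [ENNReal.toReal_mul, ENNReal.toReal_mul] at h
    simp only [ENNReal.toReal_ofNat, ENNReal.coe_toReal] at h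
    linarith
  · have h1 : dist (g θ x) (g θ₀ x) ≤ K * dist θ θ₀ :=
      (dist_le_pi_dist _ _ x).trans (hK.dist_le_mul θ θ₀)
    have h2 : dist θ θ₀ ≤ (supportRadius M θ₀ z).toReal := by
      rw [dist_edist]
      exact ENNReal.toReal_mono hr.ne (edist_le_supportRadius θ₀ hθ)
    rw [Real.dist_eq] at h1
    exact h1.trans (mul_le_mul_of_nonneg_left h2 K.2)

/-- Markov's inequality for `c * f` at level `s`, in terms of the complementary event. The level
`s = ∞` is allowed, provided that `f` is finite. -/
theorem one_sub_div_mul_lintegral_le {Ω : Type*} [MeasurableSpace Ω] {P : Measure Ω}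
    [IsProbabilityMeasure P] {f : Ω → ℝ≥0∞} (hf : Measurable f) (hf' : ∀ ω, f ω ≠ ⊤) {c s : ℝ≥0∞}
    (hc : c ≠ ⊤) (hs : 0 < s) : 1 - c / s * ∫⁻ ω, f ω ∂P ≤ P {ω | c * f ω < s} := by
  have hcompl : {ω | s ≤ c * f ω}ᶜ = {ω | c * f ω < s} := by
    ext ω
    simp
  have hmeas : MeasurableSet {ω | s ≤ c * f ω} :=
    measurableSet_le measurable_const (hf.const_mul c)
  rw [← hcompl, prob_compl_eq_one_sub hmeas]
  refine tsub_le_tsub_left ?_ 1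
  rcases eq_or_ne s ⊤ with rfl | hs'
  · have hempty : {ω | ⊤ ≤ c * f ω} = ∅ := eq_empty_of_forall_notMem fun ω hω =>
      ENNReal.mul_ne_top hc (hf' ω) (top_le_iff.1 hω)
    rw [hempty, measure_empty]
    exact zero_le
  · refine (meas_ge_le_lintegral_div (hf.const_mul c).aemeasurable hs.ne' hs').trans_eq ?_
    rw [lintegral_const_mul c hf, ENNReal.div_eq_inv_mul, ENNReal.div_eq_inv_mul, mul_assoc]

end Learning

end LearningGames

theorem mainTheorem3
    {I : Type} [Fintype I] [DecidableEq I]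
    {A : I → Type} [∀ j, Fintype (A j)] [∀ j, MeasurableSpace (A j)]
    [∀ j, DiscreteMeasurableSpace (A j)]
    {d : ℕ} (Θ : Set (Fin d → ℝ)) [CompactSpace Θ] (hΘ : Convex ℝ Θ)
    (g : Θ → Payoffs I A) (hg : IsEmbedding g) (K : ℝ≥0) (hK : LipschitzWith K g)
    {Z : Type} [Fintype Z] [MeasurableSpace Z] [DiscreteMeasurableSpace Z]
    (Q : Measure Z) [IsProbabilityMeasure Q]
    (M : Set (LearningRule Z Θ)) (θlim : Θ)
    (hshrink : ∀ᵐ z ∂(Measure.infinitePi fun _ : ℕ => Q),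
      Tendsto (fun n => supportRadius M θlim (initialData n z)) atTop (𝓝 0))
    (i : I) (a : A i) (ha : IsStrictlyRationalizable g (limitType θlim i) a) :
    0 < strictness g (limitType θlim i) a ∧
    ∀ n : ℕ, 1 ≤ n →
      1 - 2 * (K : ℝ≥0∞) / strictness g (limitType θlim i) a *
          ∫⁻ z, supportRadius M θlim z ∂(dataLaw (Measure.infinitePi fun _ : ℕ => Q) n)
        ≤ lowerConfidence g (Measure.infinitePi fun _ : ℕ => Q) M n a := by
  have hmeas : ∀ {n : ℕ}, Measurable (initialData (Z := Z) n) := fun {n} =>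
    measurable_pi_lambda _ fun k => measurable_pi_apply _
  have hpos := strictness_limitType_pos ha
  refine ⟨hpos, fun n _ => ?_⟩
  have hP : IsProbabilityMeasure (dataLaw (Measure.infinitePi fun _ : ℕ => Q) n) :=
    Measure.isProbabilityMeasure_map hmeas.aemeasurable
  refine (one_sub_div_mul_lintegral_le .of_discrete (fun z => (supportRadius_lt_top M θlim z).ne)
    (ENNReal.mul_ne_top (by simp) (by simp)) hpos).trans (measure_mono fun z hz => ?_)
  exact isStronglyRationalizable_of_lt_strictness hK hz
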